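/- All graphs are finite and simple. Let $H$ be a graph with maximum degree $\Delta(H)\le 2$, and let $G$ be obtained from $H$ by gluing in vertex-disjoint copies of $K_4$; that is, for some $q \ge 0$ and some pairwise disjoint $4$-element sets $Y_1,\dots,Y_q\subseteq V(H)$ (which need not cover $V(H)$), $V(G)=V(H)$ and two distinct vertices are adjacent in $G$ if and only if they are adjacent in $H$ or lie in a common set $Y_i$. Let $\mathcal{C}$ be the set of odd cycles in $H$ of length greater than $3$, and let $V(\mathcal{C})$ be the set of vertices contained in these cycles. Then there is a set $Z\subseteq V(\mathcal{C})$ with $|Z|\le|\mathcal{C}|/2$ such that $Z$ contains at most one vertex from each cycle of $\mathcal{C}$ and $G-Z$ is $4$-colorable. Moreover, $|V(G)\setminus Z|\ge \tfrac{9}{10}|V(G)|$. -/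

import Mathlib

/-- The graph obtained from `H` by gluing in the (vertex-disjoint) graphs `K i`, `i : ι`, along the
injection `f` of the disjoint union of their vertex sets into the vertex set of `H`: its edges are
those of `H` together with the images under `f` of the edges of the graphs `K i`. -/
def SimpleGraph.glue {V ι : Type*} {W : ι → Type*} (H : SimpleGraph V)
    (K : ∀ i, SimpleGraph (W i)) (f : (Σ i, W i) ↪ V) : SimpleGraph V where
  Adj u v := H.Adj u v ∨ ∃ i a b, (K i).Adj a b ∧ f ⟨i, a⟩ = u ∧ f ⟨i, b⟩ = v
  symm := ⟨by
    rintro u v (h | ⟨i, a, b, h, ha, hb⟩)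
    · exact Or.inl h.symm
    · exact Or.inr ⟨i, b, a, h.symm, hb, ha⟩⟩
  loopless := ⟨by
    rintro u (h | ⟨i, a, b, h, ha, hb⟩)
    · exact H.loopless.irrefl u h
    · have hab := f.injective (ha.trans hb.symm)
      simp only [Sigma.mk.injEq, heq_eq_eq, true_and] at hab
      exact h.ne hab⟩

/-- The set of odd cycles of length greater than `3` in `H`. A cycle is a subgraph, so that a closed
walk started elsewhere or traversed backwards is the same cycle. -/
def SimpleGraph.longOddCycles {V : Type*} (H : SimpleGraph V) : Set H.Subgraph :=
  {C | ∃ (v : V) (p : H.Walk v v), p.IsCycle ∧ Odd p.length ∧ 3 < p.length ∧ p.toSubgraph = C}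

/-!
The graph `H` is a disjoint union of paths and cycles. Choose a matching `m` on the vertices that
leaves uncovered one vertex `s C` of each long odd cycle `C`, alternating along `C` otherwise, and
that is given by `exists_matching_off_longOddCycles` off these cycles. Further,
let `p` be a matching consisting of two disjoint edges of each glued `K₄`. The union of two
matchings is bipartite (`exists_isProper`). A proper `2`-colouring `c` of `m ∪ p` splits each `K₄`
evenly, and every vertex `x` has at most one `H`-neighbour of its own colour, unless `x = s C` has
the colour of both its neighbours on `C`, in which case `C` is bad. Delete `s C` for each bad `C`.
Then, in each colour class of `c`, the remaining graph is again the union of two matchings, of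
monochromatic edges of `H` and of edges of the `K₄`s, so that two colours for each class suffice.

It remains to choose the `s C` and `c` with at most half of the cycles bad (`exists_few_isBad`).
If `s C` and its two neighbours are not in one component of `m ∪ p`, then exchanging the colours on
a component shows that `C` is bad for at most half of the proper colourings; otherwise `C` is bad
for all of them or for none. By averaging it suffices that the always bad cycles be at most as many
as the never bad ones. Take the `s C` such that the number of always bad cycles is minimal. If `C`
is always bad, move `s C` along `C` in steps of two. As long as `C` is always bad, each step
preserves the components of `m ∪ p`, and changes the matching only within the component `Q` of
`s C` (`conn_slide_iff`). This stops before `s C` has been everywhere: a component of what is left of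
`m ∪ p` without the edges of `C` contains at most two vertices of `C`, so, `C` being odd, one
contains only one, and `C` is not always bad when that vertex is uncovered
(`exists_not_alwaysBad`). When it stops, by minimality another cycle `D` has become always bad. Then
`D` was never bad before, and `s D` lies in `Q`, which is a path and has no uncovered vertex of `m`
other than its ends `s C` and `s D`. So `C` determines `D` and conversely
(`exists_card_alwaysBad_le`).
-/

/-! ### Unions of two matchings -/

namespace TwoMatchings

variable {X : Type*}

/-- `c` is a proper `2`-colouring of the union of the two matchings encoded by the involutions `m`
and `p`: a matching is encoded by the map exchanging the ends of its edges and fixing the uncovered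
points. -/
def IsProper (m p : X → X) (c : X → Bool) : Prop :=
  (∀ x, m x ≠ x → c (m x) ≠ c x) ∧ ∀ x, p x ≠ x → c (p x) ≠ c x

/-- Two points lie in the same component of the union of the matchings `m` and `p`. -/
def Conn (m p : X → X) : X → X → Prop :=
  Relation.EqvGen fun x y => m x = y ∨ p x = y

section Conn

variable {m p : X → X} {x y z : X}

theorem Conn.refl (x : X) : Conn m p x x := Relation.EqvGen.refl x

theorem Conn.symm (h : Conn m p x y) : Conn m p y x := Relation.EqvGen.symm _ _ h

theorem Conn.trans (h : Conn m p x y) (h' : Conn m p y z) : Conn m p x z :=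
  Relation.EqvGen.trans _ _ _ h h'

theorem Conn.left (x : X) : Conn m p x (m x) := Relation.EqvGen.rel _ _ (Or.inl rfl)

theorem Conn.right (x : X) : Conn m p x (p x) := Relation.EqvGen.rel _ _ (Or.inr rfl)

theorem Conn.mem_iff {S : Set X} (hm : ∀ x, m x ∈ S ↔ x ∈ S) (hp : ∀ x, p x ∈ S ↔ x ∈ S)
    (h : Conn m p x y) : x ∈ S ↔ y ∈ S := by
  induction h with
  | rel x y h =>
    rcases h with rfl | rfl
    · exact (hm x).symm
    · exact (hp x).symm
  | refl x => rfl
  | symm x y _ ih => exact ih.symm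
  | trans x y z _ _ ih1 ih2 => exact ih1.trans ih2

/-- For involutions it suffices that the set be stable. -/
theorem Conn.mem_of_stable {S : Set X} (hm : Function.Involutive m) (hp : Function.Involutive p)
    (hmS : ∀ x ∈ S, m x ∈ S) (hpS : ∀ x ∈ S, p x ∈ S) (h : Conn m p x y) (hx : x ∈ S) : y ∈ S :=
  (h.mem_iff (fun x => ⟨fun h => hm x ▸ hmS _ h, hmS x⟩)
    (fun x => ⟨fun h => hp x ▸ hpS _ h, hpS x⟩)).1 hx

theorem Conn.mono {m' p' : X → X} (h : Conn m p x y) (hm : ∀ x, Conn m' p' x (m x))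
    (hp : ∀ x, Conn m' p' x (p x)) : Conn m' p' x y := by
  induction h with
  | rel x y h =>
    rcases h with rfl | rfl
    · exact hm x
    · exact hp x
  | refl x => exact Conn.refl x
  | symm x y _ ih => exact ih.symm
  | trans x y z _ _ ih1 ih2 => exact ih1.trans ih2

theorem conn_left_iff : Conn m p x (m y) ↔ Conn m p x y :=
  ⟨fun h => h.trans (Conn.left y).symm, fun h => h.trans (Conn.left y)⟩

theorem conn_right_iff : Conn m p x (p y) ↔ Conn m p x y :=
  ⟨fun h => h.trans (Conn.right y).symm, fun h => h.trans (Conn.right y)⟩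

/-- Two proper colourings agree or disagree consistently on a component. -/
theorem IsProper.eq_iff_eq {c c' : X → Bool} (hc : IsProper m p c) (hc' : IsProper m p c')
    (h : Conn m p x y) : c x = c y ↔ c' x = c' y := by
  have key : x ∈ {z | (c z ^^ c' z) = (c x ^^ c' x)} ↔ y ∈ {z | (c z ^^ c' z) = (c x ^^ c' x)} := by
    refine h.mem_iff (fun z => ?_) fun z => ?_
    · by_cases hz : m z = z
      · rw [hz]
      · have h1 := hc.1 z hz
        have h2 := hc'.1 z hz
        simp only [Set.mem_ofPred_eq]
        revert h1 h2
        cases c z <;> cases c' z <;> cases c (m z) <;> cases c' (m z) <;> simp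
    · by_cases hz : p z = z
      · rw [hz]
      · have h1 := hc.2 z hz
        have h2 := hc'.2 z hz
        simp only [Set.mem_ofPred_eq]
        revert h1 h2
        cases c z <;> cases c' z <;> cases c (p z) <;> cases c' (p z) <;> simp
  have := key.1 rfl
  simp only [Set.mem_ofPred_eq] at this
  revert this
  cases c x <;> cases c' x <;> cases c y <;> cases c' y <;> simp

open Classical in
/-- The colouring `c` with the colours exchanged on the component of `u`. -/
noncomputable def flip (m p : X → X) (u : X) (c : X → Bool) : X → Bool :=
  fun x => if Conn m p u x then !(c x) else c x

theorem IsProper.flip {c : X → Bool} (hc : IsProper m p c) (u : X) :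
    IsProper m p (flip m p u c) := by
  constructor
  · intro x hx
    have := hc.1 x hx
    unfold TwoMatchings.flip
    rw [conn_left_iff]
    split_ifs <;> simpa using this
  · intro x hx
    have := hc.2 x hx
    unfold TwoMatchings.flip
    rw [conn_right_iff]
    split_ifs <;> simpa using this

theorem flip_flip (u : X) (c : X → Bool) : flip m p u (flip m p u c) = c := by
  funext x
  unfold flip
  split_ifs <;> simp

theorem flip_of_conn {u : X} (c : X → Bool) (h : Conn m p u x) : flip m p u c x = !(c x) :=
  if_pos h

theorem flip_of_not_conn {u : X} (c : X → Bool) (h : ¬ Conn m p u x) : flip m p u c x = c x :=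
  if_neg h

end Conn

section Path

variable {m p : X → X} {u v w : X}

/-- The alternating walk `u, p u, m (p u), …`. -/
def altWalk (m p : X → X) (u : X) : ℕ → X
  | 0 => u
  | i + 1 => if Even i then p (altWalk m p u i) else m (altWalk m p u i)

theorem altWalk_succ_of_even {i : ℕ} (h : Even i) :
    altWalk m p u (i + 1) = p (altWalk m p u i) := if_pos h

theorem altWalk_succ_of_odd {i : ℕ} (h : ¬ Even i) :
    altWalk m p u (i + 1) = m (altWalk m p u i) := if_neg h

/-- The alternating walk from an `m`-uncovered point covers its component; once the walk stalls
it has already done so. -/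
theorem exists_altWalk_eq (hm : Function.Involutive m) (hp : Function.Involutive p) (hu : m u = u)
    (h : Conn m p u v) {N : ℕ∞}
    (hN : ∀ i : ℕ, (i : ℕ∞) = N → altWalk m p u (i + 1) = altWalk m p u i) :
    ∃ i : ℕ, (i : ℕ∞) ≤ N ∧ altWalk m p u i = v := by
  refine Conn.mem_of_stable (S := {v | ∃ i : ℕ, (i : ℕ∞) ≤ N ∧ altWalk m p u i = v}) hm hp
    ?_ ?_ h ⟨0, by simp, rfl⟩
  · rintro _ ⟨i, hi, rfl⟩
    by_cases he : Even i
    · rcases i with _ | i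
      · exact ⟨0, hi, hu.symm⟩
      · have he' : ¬ Even i := by simpa [Nat.even_add_one] using he
        refine ⟨i, le_trans (by exact_mod_cast Nat.le_succ i) hi, ?_⟩
        rw [altWalk_succ_of_odd he', hm]
    · rcases hi.lt_or_eq with hlt | heq
      · exact ⟨i + 1, by exact_mod_cast Order.add_one_le_of_lt hlt, altWalk_succ_of_odd he⟩
      · exact ⟨i, hi, ((altWalk_succ_of_odd he).symm.trans (hN i heq)).symm⟩
  · rintro _ ⟨i, hi, rfl⟩
    by_cases he : Even i
    · rcases hi.lt_or_eq with hlt | heq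
      · exact ⟨i + 1, by exact_mod_cast Order.add_one_le_of_lt hlt, altWalk_succ_of_even he⟩
      · exact ⟨i, hi, ((altWalk_succ_of_even he).symm.trans (hN i heq)).symm⟩
    · rcases i with _ | i
      · simp at he
      · have he' : Even i := by simpa [Nat.even_add_one] using he
        refine ⟨i, le_trans (by exact_mod_cast Nat.le_succ i) hi, ?_⟩
        rw [altWalk_succ_of_even he', hp]

theorem IsProper.altWalk {c : X → Bool} (hc : IsProper m p c) {j : ℕ}
    (hj : ∀ i < j, altWalk m p u (i + 1) ≠ altWalk m p u i) :
    c (altWalk m p u j) = (c u ^^ decide (¬ Even j)) := by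
  induction j with
  | zero => simp [TwoMatchings.altWalk]
  | succ j ih =>
    have ih := ih fun i hi => hj i (hi.trans j.lt_succ_self)
    have hne := hj j j.lt_succ_self
    have : c (TwoMatchings.altWalk m p u (j + 1)) ≠ c (TwoMatchings.altWalk m p u j) := by
      by_cases he : Even j
      · rw [altWalk_succ_of_even he] at hne ⊢
        exact hc.2 _ hne
      · rw [altWalk_succ_of_odd he] at hne ⊢
        exact hc.1 _ hne
    rw [ih] at this
    rw [Bool.eq_not_of_ne this]
    by_cases he : Even j <;> simp [he, Nat.even_add_one]

/-- A second `m`-uncovered point of the component of `u` is the end of a path from `u` that starts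
and ends with an edge of `p`. -/
theorem exists_first_stall (hm : Function.Involutive m) (hp : Function.Involutive p) (hu : m u = u)
    (h : Conn m p u v) (hv : m v = v) (hne : v ≠ u) :
    ∃ j : ℕ, ¬ Even j ∧ altWalk m p u j = v ∧ altWalk m p u (j + 1) = altWalk m p u j ∧
      ∀ i < j, altWalk m p u (i + 1) ≠ altWalk m p u i := by
  classical
  have hex : ∃ i, altWalk m p u i = v := by
    obtain ⟨i, -, hi⟩ := exists_altWalk_eq hm hp hu h (N := ⊤) (by simp)
    exact ⟨i, hi⟩
  obtain ⟨j, hj, hmin⟩ : ∃ j, altWalk m p u j = v ∧ ∀ i < j, altWalk m p u i ≠ v :=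
    ⟨Nat.find hex, Nat.find_spec hex, fun i hi => Nat.find_min hex hi⟩
  have hodd : ¬ Even j := by
    intro he
    rcases j with _ | j
    · exact hne hj.symm
    · have he' : ¬ Even j := by simpa [Nat.even_add_one] using he
      refine hmin j j.lt_succ_self ?_
      have hj' := altWalk_succ_of_odd (m := m) (p := p) (u := u) he'
      rw [← hm (altWalk m p u j), ← hj', hj, hv]
  refine ⟨j, hodd, hj, by rw [altWalk_succ_of_odd hodd, hj, hv], fun i hi hstall => ?_⟩
  obtain ⟨l, hl, hlv⟩ := exists_altWalk_eq hm hp hu h (N := i) fun l hl => by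
    obtain rfl : l = i := by exact_mod_cast hl
    exact hstall
  exact hmin l (lt_of_le_of_lt (by exact_mod_cast hl) hi) hlv

theorem IsProper.ne_of_uncovered {c : X → Bool} (hc : IsProper m p c)
    (hm : Function.Involutive m) (hp : Function.Involutive p) (hu : m u = u)
    (h : Conn m p u v) (hv : m v = v) (hne : v ≠ u) : c v ≠ c u := by
  obtain ⟨j, hodd, rfl, -, hj⟩ := exists_first_stall hm hp hu h hv hne
  rw [hc.altWalk hj]
  simp [hodd]

/-- A component has at most two `m`-uncovered points. -/
theorem eq_of_uncovered (hm : Function.Involutive m) (hp : Function.Involutive p) (hu : m u = u)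
    (hv : m v = v) (hw : m w = w) (huv : Conn m p u v) (huw : Conn m p u w)
    (hvu : v ≠ u) (hwu : w ≠ u) : v = w := by
  obtain ⟨j, -, rfl, hj, hj'⟩ := exists_first_stall hm hp hu huv hv hvu
  obtain ⟨l, -, rfl, hl, hl'⟩ := exists_first_stall hm hp hu huw hw hwu
  rcases lt_trichotomy j l with h | rfl | h
  · exact absurd hj (hl' j h)
  · rfl
  · exact absurd hl (hj' l h)

end Path

/-- The union of two matchings is bipartite. -/
theorem exists_isProper [Finite X] {m p : X → X} (hm : Function.Involutive m)
    (hp : Function.Involutive p) : ∃ c, IsProper m p c := by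
  classical
  obtain ⟨k, hk⟩ : ∃ k, {x | m x ≠ x}.ncard = k := ⟨_, rfl⟩
  induction k using Nat.strong_induction_on generalizing m with
  | _ k ih =>
    by_cases h : ∃ u, m u ≠ u
    · obtain ⟨u, hu⟩ := h
      -- remove the edge `{u, m u}` from the first matching
      let m' : X → X := fun x => if x = u ∨ x = m u then x else m x
      have hm'u : m' u = u := if_pos (Or.inl rfl)
      have hm'v : m' (m u) = m u := if_pos (Or.inr rfl)
      have hm'x : ∀ x, x ≠ u → x ≠ m u → m' x = m x := fun x h1 h2 => if_neg (by tauto)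
      have hm' : Function.Involutive m' := by
        intro x
        by_cases h1 : x = u
        · rw [h1, hm'u, hm'u]
        by_cases h2 : x = m u
        · rw [h2, hm'v, hm'v]
        have h3 : m x ≠ u := fun h => h2 (by rw [← h, hm])
        have h4 : m x ≠ m u := fun h => h1 (hm.injective h)
        rw [hm'x x h1 h2, hm'x _ h3 h4, hm]
      have hlt : {x | m' x ≠ x}.ncard < k := by
        rw [← hk]
        refine Set.ncard_lt_ncard ⟨fun x hx => ?_, fun hsub => hsub hu hm'u⟩ (Set.toFinite _)
        by_cases h1 : x = u
        · exact absurd (h1 ▸ hm'u) hx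
        by_cases h2 : x = m u
        · exact absurd (h2 ▸ hm'v) hx
        simpa [hm'x x h1 h2] using hx
      obtain ⟨c, hc⟩ := ih _ hlt hm' rfl
      have lift : ∀ c, IsProper m' p c → c (m u) ≠ c u → IsProper m p c := by
        refine fun c hc hne => ⟨fun x hx => ?_, hc.2⟩
        by_cases h1 : x = u
        · rwa [h1]
        by_cases h2 : x = m u
        · rw [h2, hm]
          exact hne.symm
        rw [← hm'x x h1 h2] at hx ⊢
        exact hc.1 x hx
      by_cases hcu : c (m u) = c u
      · refine ⟨_, lift _ (hc.flip u) ?_⟩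
        rw [flip_of_conn c (Conn.refl u), flip_of_not_conn c fun hconn =>
          hc.ne_of_uncovered hm' hp hm'u hconn hm'v hu hcu, hcu]
        simp
      · exact ⟨c, lift c hc hcu⟩
    · push Not at h
      obtain ⟨n, ⟨e⟩⟩ := Finite.exists_equiv_fin X
      refine ⟨fun x => decide (e x < e (p x)), fun x hx => absurd (h x) hx, fun x hx => ?_⟩
      have : e (p x) ≠ e x := fun h => hx (e.injective h)
      simp only [hp x]
      rcases this.lt_or_gt with h | h <;> simp [h, h.not_gt]

/-- A relation that matches each point with at most one other is encoded by an involution. -/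
theorem exists_involutive_of_matching {R : X → X → Prop} (hs : ∀ x y, R x y → R y x)
    (hu : ∀ x y z, R x y → R x z → y = z) :
    ∃ m : X → X, Function.Involutive m ∧ (∀ x y, R x y → m x = y) ∧
      ∀ x, R x (m x) ∨ m x = x := by
  classical
  have key : ∀ x, ∃ y, R x y ∨ (y = x ∧ ∀ z, ¬ R x z) := by
    intro x
    by_cases h : ∃ y, R x y
    · exact ⟨h.choose, Or.inl h.choose_spec⟩
    · push Not at h
      exact ⟨x, Or.inr ⟨rfl, h⟩⟩
  choose m hm using key
  have hm' : ∀ x y, R x y → m x = y := by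
    intro x y h
    rcases hm x with h' | ⟨-, h'⟩
    · exact hu _ _ _ h' h
    · exact absurd h (h' y)
  refine ⟨m, fun x => ?_, hm', fun x => (hm x).imp_right And.left⟩
  rcases hm x with h' | ⟨h, -⟩
  · exact hm' _ _ (hs _ _ h')
  · rw [h, h]

/-- A version of `exists_isProper` for matchings given as relations. -/
theorem exists_coloring_of_matchings [Finite X] {R S : X → X → Prop}
    (hRs : ∀ x y, R x y → R y x) (hRu : ∀ x y z, R x y → R x z → y = z) (hRi : ∀ x, ¬ R x x)
    (hSs : ∀ x y, S x y → S y x) (hSu : ∀ x y z, S x y → S x z → y = z) (hSi : ∀ x, ¬ S x x) :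
    ∃ c : X → Bool, (∀ x y, R x y → c x ≠ c y) ∧ ∀ x y, S x y → c x ≠ c y := by
  obtain ⟨m, hm, hmR, -⟩ := exists_involutive_of_matching hRs hRu
  obtain ⟨p, hp, hpS, -⟩ := exists_involutive_of_matching hSs hSu
  obtain ⟨c, hc⟩ := exists_isProper hm hp
  refine ⟨c, fun x y h => ?_, fun x y h => ?_⟩
  · have := hc.1 x (by rw [hmR x y h]; rintro rfl; exact hRi _ h)
    rw [hmR x y h] at this
    exact this.symm
  · have := hc.2 x (by rw [hpS x y h]; rintro rfl; exact hSi _ h)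
    rw [hpS x y h] at this
    exact this.symm

/-! ### Sliding the uncovered vertex of a matching -/

section Slide

variable {X : Type*} {m m' p : X → X} {u v w : X}

/-- Replacing the edge `vw` of `m` by `uv`, where `u` is uncovered, does not change the components
if `u` and `v` are connected and have the same colour: in the absence of `vw` the points `u` and `v`
are not connected, since both are uncovered then, so that `u` is still connected to `w`. -/
theorem conn_slide_iff (hm : Function.Involutive m) (hp : Function.Involutive p)
    (hmu : m u = u) (hmv : m v = w) (hmw' : m' w = w) (hmu' : m' u = v) (hmv' : m' v = u)
    (huv : u ≠ v) (heq : ∀ x, x ≠ u → x ≠ v → x ≠ w → m' x = m x)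
    {c : X → Bool} (hc : IsProper m p c) (hcuv : c u = c v) (hconn : Conn m p u v) {x y : X} :
    Conn m p x y ↔ Conn m' p x y := by
  classical
  have hmw : m w = v := by rw [← hmv, hm]
  let m₀ : X → X := fun x => if x = v ∨ x = w then x else m x
  have hv₀ : m₀ v = v := if_pos (Or.inl rfl)
  have hw₀ : m₀ w = w := if_pos (Or.inr rfl)
  have h₀ : ∀ x, x ≠ v → x ≠ w → m₀ x = m x := fun x h1 h2 => if_neg (by tauto)
  have huw : u ≠ w := by
    rintro rfl
    exact huv (hmu.symm.trans hmw)
  have hu₀ : m₀ u = u := by rw [h₀ u huv huw, hmu]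
  have hm₀ : Function.Involutive m₀ := by
    intro x
    by_cases h1 : x = v
    · rw [h1, hv₀, hv₀]
    by_cases h2 : x = w
    · rw [h2, hw₀, hw₀]
    have h3 : m x ≠ v := fun h => h2 (by rw [← hm x, h, hmv])
    have h4 : m x ≠ w := fun h => h1 (by rw [← hm x, h, hmw])
    rw [h₀ x h1 h2, h₀ _ h3 h4, hm]
  have hc₀ : IsProper m₀ p c := by
    refine ⟨fun x hx => ?_, hc.2⟩
    by_cases h1 : x = v
    · exact absurd (h1 ▸ hv₀) hx
    by_cases h2 : x = w
    · exact absurd (h2 ▸ hw₀) hx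
    rw [h₀ x h1 h2] at hx ⊢
    exact hc.1 x hx
  have hnot : ¬ Conn m₀ p u v := fun h =>
    hc₀.ne_of_uncovered hm₀ hp hu₀ h hv₀ huv.symm hcuv.symm
  have huw₀ : Conn m₀ p u w := by
    by_contra hcon
    refine hnot (Conn.mem_of_stable (S := {x | Conn m₀ p u x}) hm hp (fun x hx => ?_)
      (fun x hx => conn_right_iff.2 hx) hconn (Conn.refl u))
    rw [← h₀ x (by rintro rfl; exact hnot hx) (by rintro rfl; exact hcon hx)]
    exact conn_left_iff.2 hx
  have h₀' : ∀ {x y}, Conn m₀ p x y → Conn m' p x y := by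
    refine fun h => h.mono (fun x => ?_) fun x => Conn.right x
    by_cases h1 : x = v
    · rw [h1, hv₀]
      exact Conn.refl v
    by_cases h2 : x = w
    · rw [h2, hw₀]
      exact Conn.refl w
    by_cases h3 : x = u
    · rw [h3, hu₀]
      exact Conn.refl u
    rw [h₀ x h1 h2, ← heq x h3 h1 h2]
    exact Conn.left x
  have huv' : Conn m' p u v := hmu' ▸ Conn.left u
  constructor
  · refine fun h => h.mono (fun x => ?_) fun x => Conn.right x
    by_cases h1 : x = v
    · rw [h1, hmv]
      exact huv'.symm.trans (h₀' huw₀)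
    by_cases h2 : x = w
    · rw [h2, hmw]
      exact (h₀' huw₀).symm.trans huv'
    by_cases h3 : x = u
    · rw [h3, hmu]
      exact Conn.refl u
    rw [← heq x h3 h1 h2]
    exact Conn.left x
  · refine fun h => h.mono (fun x => ?_) fun x => Conn.right x
    by_cases h1 : x = v
    · rw [h1, hmv']
      exact hconn.symm
    by_cases h2 : x = w
    · rw [h2, hmw']
      exact Conn.refl w
    by_cases h3 : x = u
    · rw [h3, hmu']
      exact hconn
    rw [heq x h3 h1 h2]
    exact Conn.left x

end Slide

/-! ### Near-perfect matchings of an odd cycle -/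

section OddCycle

variable {k : ℕ}

/-- The matching `{s + 1, s + 2}, {s + 3, s + 4}, …` of the odd cycle on `ZMod (2 * k + 1)`, which
leaves only `s` uncovered. -/
def cycleMatch (s a : ZMod (2 * k + 1)) : ZMod (2 * k + 1) :=
  if a = s then s else if Odd (a - s).val then a + 1 else a - 1

theorem cycleMatch_self (s : ZMod (2 * k + 1)) : cycleMatch s s = s := if_pos rfl

theorem exists_eq_add_natCast (s a : ZMod (2 * k + 1)) : ∃ r < 2 * k + 1, a = s + (r : ℕ) :=
  ⟨(a - s).val, ZMod.val_lt _, by rw [ZMod.natCast_zmod_val]; ring⟩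

theorem add_natCast_ne {s : ZMod (2 * k + 1)} {r : ℕ} (hr : 0 < r) (hr' : r < 2 * k + 1) :
    s + (r : ℕ) ≠ s := by
  intro h
  have h0 : ((r : ℕ) : ZMod (2 * k + 1)) = 0 := by simpa using h
  rw [ZMod.natCast_eq_zero_iff] at h0
  exact absurd (Nat.le_of_dvd hr h0) (by omega)

theorem val_add_natCast_sub {s : ZMod (2 * k + 1)} {r : ℕ} (hr : r < 2 * k + 1) :
    (s + (r : ℕ) - s).val = r := by
  rw [add_sub_cancel_left, ZMod.val_natCast_of_lt hr]

theorem cycleMatch_odd (s : ZMod (2 * k + 1)) {j : ℕ} (hj : j < k) :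
    cycleMatch s (s + (2 * j + 1 : ℕ)) = s + (2 * j + 2 : ℕ) := by
  rw [cycleMatch, if_neg (add_natCast_ne (by omega) (by omega)),
    val_add_natCast_sub (by omega), if_pos (by simp)]
  push_cast
  ring

theorem cycleMatch_even (s : ZMod (2 * k + 1)) {j : ℕ} (hj : j < k) :
    cycleMatch s (s + (2 * j + 2 : ℕ)) = s + (2 * j + 1 : ℕ) := by
  rw [cycleMatch, if_neg (add_natCast_ne (by omega) (by omega)),
    val_add_natCast_sub (by omega), if_neg (by simp [Nat.even_add])]
  push_cast
  ring

theorem cycle_cases (s a : ZMod (2 * k + 1)) :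
    a = s ∨ (∃ j < k, a = s + (2 * j + 1 : ℕ)) ∨ ∃ j < k, a = s + (2 * j + 2 : ℕ) := by
  obtain ⟨r, hr, rfl⟩ := exists_eq_add_natCast s a
  rcases Nat.even_or_odd' r with ⟨j, rfl | rfl⟩
  · rcases j with _ | j
    · simp
    · exact Or.inr (Or.inr ⟨j, by omega, rfl⟩)
  · exact Or.inr (Or.inl ⟨j, by omega, rfl⟩)

theorem cycleMatch_eq_or {s a : ZMod (2 * k + 1)} (h : a ≠ s) :
    cycleMatch s a = a + 1 ∨ cycleMatch s a = a - 1 := by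
  rw [cycleMatch, if_neg h]
  split_ifs
  · exact Or.inl rfl
  · exact Or.inr rfl

theorem cycleMatch_involutive (s : ZMod (2 * k + 1)) : Function.Involutive (cycleMatch s) := by
  intro a
  rcases cycle_cases s a with rfl | ⟨j, hj, rfl⟩ | ⟨j, hj, rfl⟩
  · simp [cycleMatch_self]
  · rw [cycleMatch_odd s hj, cycleMatch_even s hj]
  · rw [cycleMatch_even s hj, cycleMatch_odd s hj]

theorem two_mul_add_one_eq_zero : (2 * k + 1 : ZMod (2 * k + 1)) = 0 := by
  have := ZMod.natCast_self (2 * k + 1)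
  push_cast at this
  exact this

theorem cycleMatch_add_one (hk : 0 < k) (s : ZMod (2 * k + 1)) :
    cycleMatch s (s + 1) = s + 2 := by
  simpa using cycleMatch_odd s hk

theorem cycleMatch_add_two_self (hk : 0 < k) (s : ZMod (2 * k + 1)) :
    cycleMatch (s + 2) s = s + 1 := by
  have h := cycleMatch_odd (s + 2) (j := k - 1) (by omega)
  have h0 := two_mul_add_one_eq_zero (k := k)
  obtain ⟨k, rfl⟩ : ∃ l, k = l + 1 := ⟨k - 1, by omega⟩
  simp only [Nat.add_sub_cancel] at h
  push_cast at h0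
  have e1 : s + 2 + (2 * k + 1 : ℕ) = s := by
    push_cast
    linear_combination h0
  have e2 : s + 2 + (2 * k + 2 : ℕ) = s + 1 := by
    push_cast
    linear_combination h0
  rwa [e1, e2] at h

theorem cycleMatch_add_two_add_one (hk : 0 < k) (s : ZMod (2 * k + 1)) :
    cycleMatch (s + 2) (s + 1) = s := by
  rw [← cycleMatch_add_two_self hk, cycleMatch_involutive]

theorem cycleMatch_add_two (s : ZMod (2 * k + 1)) {a : ZMod (2 * k + 1)} (h0 : a ≠ s)
    (h1 : a ≠ s + 1) (h2 : a ≠ s + 2) : cycleMatch (s + 2) a = cycleMatch s a := by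
  rcases cycle_cases s a with rfl | ⟨j, hj, rfl⟩ | ⟨j, hj, rfl⟩
  · exact absurd rfl h0
  · rcases j with _ | j
    · simp at h1
    rw [cycleMatch_odd s hj]
    have e1 : s + (2 * (j + 1) + 1 : ℕ) = s + 2 + (2 * j + 1 : ℕ) := by
      push_cast
      ring
    have e2 : s + (2 * (j + 1) + 2 : ℕ) = s + 2 + (2 * j + 2 : ℕ) := by
      push_cast
      ring
    rw [e1, e2, cycleMatch_odd (s + 2) (by omega)]
  · rcases j with _ | j
    · simp at h2
    rw [cycleMatch_even s hj]
    have e1 : s + (2 * (j + 1) + 2 : ℕ) = s + 2 + (2 * j + 2 : ℕ) := by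
      push_cast
      ring
    have e2 : s + (2 * (j + 1) + 1 : ℕ) = s + 2 + (2 * j + 1 : ℕ) := by
      push_cast
      ring
    rw [e1, e2, cycleMatch_even (s + 2) (by omega)]

theorem add_one_ne_self (hk : 0 < k) (s : ZMod (2 * k + 1)) : s + 1 ≠ s := by
  simpa using add_natCast_ne (s := s) one_pos (by omega : 1 < 2 * k + 1)

/-- Steps of length two reach every vertex of an odd cycle. -/
theorem exists_add_two_mul (s a : ZMod (2 * k + 1)) : ∃ t : ℕ, s + 2 * (t : ZMod _) = a := by
  refine ⟨(k + 1) * (a - s).val, ?_⟩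
  push_cast
  rw [ZMod.natCast_zmod_val]
  linear_combination (a - s) * two_mul_add_one_eq_zero (k := k)

theorem exists_fixed_of_involutive {g : ZMod (2 * k + 1) → ZMod (2 * k + 1)}
    (hg : Function.Involutive g) : ∃ a, g a = a := by
  by_contra! h
  have h0 : ∑ _a : ZMod (2 * k + 1), (1 : ZMod 2) = 0 :=
    Finset.sum_involution (fun a _ => g a) (fun _ _ => by decide) (fun a _ _ => h a)
      (fun _ _ => Finset.mem_univ _) fun a _ => hg a
  simp only [Finset.sum_const, Finset.card_univ, ZMod.card, nsmul_eq_mul, mul_one] at h0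
  rw [ZMod.natCast_eq_zero_iff] at h0
  omega

end OddCycle

/-! ### Colourings of a disjoint union of odd cycles and a matched set -/

section Family

variable {ι W : Type*} {k : ι → ℕ}

/-- The matching on the disjoint union of the odd cycles `ZMod (2 * k i + 1)` and of `W` that leaves
only the vertex `s i` of the `i`-th cycle uncovered, and is `m₀` on `W`. -/
def familyMatch (m₀ : W → W) (s : ∀ i, ZMod (2 * k i + 1)) :
    (Σ i, ZMod (2 * k i + 1)) ⊕ W → (Σ i, ZMod (2 * k i + 1)) ⊕ W
  | .inl ⟨i, a⟩ => .inl ⟨i, cycleMatch (s i) a⟩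
  | .inr w => .inr (m₀ w)

/-- The vertex at distance `d` from the uncovered vertex of the `i`-th cycle. -/
def near (W : Type*) (s : ∀ i, ZMod (2 * k i + 1)) (i : ι) (d : ZMod (2 * k i + 1)) :
    (Σ i, ZMod (2 * k i + 1)) ⊕ W := .inl ⟨i, s i + d⟩

/-- The `i`-th cycle is bad for `c` if its uncovered vertex has the colour of both neighbours. -/
def IsBad (s : ∀ i, ZMod (2 * k i + 1)) (i : ι) (c : (Σ i, ZMod (2 * k i + 1)) ⊕ W → Bool) : Prop :=
  c (near W s i 0) = c (near W s i 1) ∧ c (near W s i 0) = c (near W s i (-1))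

variable {m₀ : W → W} {p : (Σ i, ZMod (2 * k i + 1)) ⊕ W → (Σ i, ZMod (2 * k i + 1)) ⊕ W}
  {s : ∀ i, ZMod (2 * k i + 1)} {i : ι}

theorem familyMatch_involutive (hm₀ : Function.Involutive m₀) (s : ∀ i, ZMod (2 * k i + 1)) :
    Function.Involutive (familyMatch m₀ s) := by
  rintro (⟨i, a⟩ | w)
  · simp [familyMatch, cycleMatch_involutive (s i) a]
  · simp [familyMatch, hm₀ w]

theorem familyMatch_near_zero (m₀ : W → W) (s : ∀ i, ZMod (2 * k i + 1)) (i : ι) :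
    familyMatch m₀ s (near W s i 0) = near W s i 0 := by
  simp [familyMatch, near, cycleMatch_self]

/-- The `i`-th cycle is bad for every proper colouring. -/
def AlwaysBad (m₀ : W → W) (p : (Σ i, ZMod (2 * k i + 1)) ⊕ W → (Σ i, ZMod (2 * k i + 1)) ⊕ W)
    (s : ∀ i, ZMod (2 * k i + 1)) (i : ι) : Prop :=
  ∀ c, IsProper (familyMatch m₀ s) p c → IsBad s i c

/-- The `i`-th cycle is bad for no proper colouring. -/
def NeverBad (m₀ : W → W) (p : (Σ i, ZMod (2 * k i + 1)) ⊕ W → (Σ i, ZMod (2 * k i + 1)) ⊕ W)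
    (s : ∀ i, ZMod (2 * k i + 1)) (i : ι) : Prop :=
  ∀ c, IsProper (familyMatch m₀ s) p c → ¬ IsBad s i c

/-- If the uncovered vertex is not connected to one of its neighbours, exchanging the colours on the
component of that neighbour repairs a bad cycle. -/
theorem exists_flip_not_isBad
    (h : ¬ (Conn (familyMatch m₀ s) p (near W s i 0) (near W s i 1) ∧
      Conn (familyMatch m₀ s) p (near W s i 0) (near W s i (-1)))) :
    ∃ u, ∀ c, IsBad s i c → ¬ IsBad s i (flip (familyMatch m₀ s) p u c) := by
  by_cases h1 : Conn (familyMatch m₀ s) p (near W s i 0) (near W s i 1)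
  · have h2 := fun h2 => h ⟨h1, h2⟩
    refine ⟨near W s i (-1), fun c hc hc' => ?_⟩
    have := hc'.2
    rw [flip_of_conn _ (Conn.refl _), flip_of_not_conn _ fun h => h2 h.symm, hc.2] at this
    simp at this
  · refine ⟨near W s i 1, fun c hc hc' => ?_⟩
    have := hc'.1
    rw [flip_of_conn _ (Conn.refl _), flip_of_not_conn _ fun h => h1 h.symm, hc.1] at this
    simp at this

theorem AlwaysBad.conn [Finite ι] [Finite W] (hm₀ : Function.Involutive m₀)
    (hp : Function.Involutive p) (h : AlwaysBad m₀ p s i) :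
    Conn (familyMatch m₀ s) p (near W s i 0) (near W s i 1) ∧
      Conn (familyMatch m₀ s) p (near W s i 0) (near W s i (-1)) := by
  by_contra hcon
  obtain ⟨u, hu⟩ := exists_flip_not_isBad hcon
  obtain ⟨c, hc⟩ := exists_isProper (familyMatch_involutive hm₀ s) hp
  exact hu c (h c hc) (h _ (hc.flip u))

theorem IsProper.isBad_iff {c c' : (Σ i, ZMod (2 * k i + 1)) ⊕ W → Bool}
    (hc : IsProper (familyMatch m₀ s) p c) (hc' : IsProper (familyMatch m₀ s) p c')
    (h : Conn (familyMatch m₀ s) p (near W s i 0) (near W s i 1) ∧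
      Conn (familyMatch m₀ s) p (near W s i 0) (near W s i (-1))) :
    IsBad s i c ↔ IsBad s i c' :=
  and_congr (hc.eq_iff_eq hc' h.1) (hc.eq_iff_eq hc' h.2)

end Family

/-! ### Few bad cycles -/

section Family

variable {ι W : Type*} {k : ι → ℕ} {m₀ : W → W}
  {p : (Σ i, ZMod (2 * k i + 1)) ⊕ W → (Σ i, ZMod (2 * k i + 1)) ⊕ W}
  {s : ∀ i, ZMod (2 * k i + 1)} {i : ι}

open Classical in
/-- A cycle that is not always bad is bad for at most half of the proper colourings, and for none of
them if it is never bad. -/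
theorem two_mul_card_isBad_le [Fintype ι] [Fintype W] (i : ι) :
    2 * ({c | IsProper (familyMatch m₀ s) p c ∧ IsBad s i c} : Finset _).card +
        ({c | IsProper (familyMatch m₀ s) p c} : Finset _).card *
          (if NeverBad m₀ p s i then 1 else 0)
      ≤ ({c | IsProper (familyMatch m₀ s) p c} : Finset _).card *
        (1 + if AlwaysBad m₀ p s i then 1 else 0) := by
  have hsub : ({c | IsProper (familyMatch m₀ s) p c ∧ IsBad s i c} : Finset _) ⊆
      ({c | IsProper (familyMatch m₀ s) p c} : Finset _) :=
    Finset.monotone_filter_right _ fun c _ h => h.1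
  have hle := Finset.card_le_card hsub
  by_cases hN : NeverBad m₀ p s i
  · have h0 : ({c | IsProper (familyMatch m₀ s) p c ∧ IsBad s i c} : Finset _) = ∅ :=
      Finset.filter_eq_empty_iff.2 fun c _ h => hN c h.1 h.2
    rw [h0, if_pos hN]
    simp only [Finset.card_empty]
    split_ifs <;> omega
  rw [if_neg hN]
  by_cases hA : AlwaysBad m₀ p s i
  · rw [if_pos hA]
    omega
  rw [if_neg hA]
  have hcon : ¬ (Conn (familyMatch m₀ s) p (near W s i 0) (near W s i 1) ∧
      Conn (familyMatch m₀ s) p (near W s i 0) (near W s i (-1))) := by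
    intro hcon
    unfold NeverBad at hN
    unfold AlwaysBad at hA
    push Not at hN hA
    obtain ⟨c, hc, hcb⟩ := hN
    obtain ⟨c', hc', hcb'⟩ := hA
    exact hcb' ((hc.isBad_iff hc' hcon).1 hcb)
  obtain ⟨u, hu⟩ := exists_flip_not_isBad hcon
  have hinj : ({c | IsProper (familyMatch m₀ s) p c ∧ IsBad s i c} : Finset _).card ≤
      (({c | IsProper (familyMatch m₀ s) p c} : Finset _) \
        ({c | IsProper (familyMatch m₀ s) p c ∧ IsBad s i c} : Finset _)).card := by
    refine Finset.card_le_card_of_injOn (flip (familyMatch m₀ s) p u) (fun c hc => ?_)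
      ((Function.LeftInverse.injective fun c => flip_flip u c).injOn)
    simp only [Finset.coe_filter, Finset.mem_univ, true_and, Set.mem_ofPred_eq] at hc
    simp only [Finset.coe_sdiff, Finset.coe_filter, Finset.mem_univ, true_and, Set.mem_sdiff,
      Set.mem_ofPred_eq, not_and]
    exact ⟨hc.1.flip u, fun _ => hu c hc.2⟩
  rw [Finset.card_sdiff_of_subset hsub] at hinj
  omega

open Classical in
/-- Averaging over all proper colourings. -/
theorem exists_two_mul_card_isBad_le [Fintype ι] [Fintype W] (hm₀ : Function.Involutive m₀)
    (hp : Function.Involutive p)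
    (h : ({i | AlwaysBad m₀ p s i} : Finset ι).card ≤ ({i | NeverBad m₀ p s i} : Finset ι).card) :
    ∃ c, IsProper (familyMatch m₀ s) p c ∧
      2 * ({i | IsBad s i c} : Finset ι).card ≤ Fintype.card ι := by
  let P : Finset ((Σ i, ZMod (2 * k i + 1)) ⊕ W → Bool) := {c | IsProper (familyMatch m₀ s) p c}
  obtain ⟨c₀, hc₀⟩ := exists_isProper (familyMatch_involutive hm₀ s) hp
  have hP : P.Nonempty := ⟨c₀, by simpa [P] using hc₀⟩
  have hsum : ∑ c ∈ P, ({i | IsBad s i c} : Finset ι).card =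
      ∑ i, ({c | IsProper (familyMatch m₀ s) p c ∧ IsBad s i c} : Finset _).card := by
    simp only [Finset.card_filter, P]
    rw [Finset.sum_comm]
    refine Finset.sum_congr rfl fun i _ => ?_
    rw [Finset.sum_filter]
    refine Finset.sum_congr rfl fun c _ => ?_
    by_cases h1 : IsProper (familyMatch m₀ s) p c <;> simp [h1]
  have htot := Finset.sum_le_sum fun i (_ : i ∈ (Finset.univ : Finset ι)) =>
    two_mul_card_isBad_le (m₀ := m₀) (p := p) (s := s) i
  rw [Finset.sum_add_distrib, ← Finset.mul_sum, ← Finset.mul_sum, ← Finset.mul_sum, ← hsum,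
    Finset.sum_add_distrib, ← Finset.card_filter, ← Finset.card_filter, Finset.sum_const,
    Finset.card_univ, smul_eq_mul, mul_one] at htot
  have hle : ∑ c ∈ P, 2 * ({i | IsBad s i c} : Finset ι).card ≤ ∑ _c ∈ P, Fintype.card ι := by
    rw [← Finset.mul_sum, Finset.sum_const, smul_eq_mul]
    have := Nat.mul_le_mul_left P.card h
    simp only [mul_add] at htot
    simp only [P] at this htot ⊢
    omega
  obtain ⟨c, hc, hcle⟩ := Finset.exists_le_of_sum_le hP hle
  exact ⟨c, by simpa [P] using hc, hcle⟩

variable [DecidableEq ι]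

/-- Some vertex of the `i`-th cycle, when left uncovered, is connected to no other vertex of that
cycle: with all edges of the cycle removed a component contains at most two of its vertices, and
their number is odd. -/
theorem exists_not_alwaysBad [Finite ι] [Finite W] (hk : ∀ i, 0 < k i)
    (hm₀ : Function.Involutive m₀) (hp : Function.Involutive p) (s : ∀ i, ZMod (2 * k i + 1))
    (i : ι) : ∃ a, ¬ AlwaysBad m₀ p (Function.update s i a) i := by
  let m : (Σ i, ZMod (2 * k i + 1)) ⊕ W → (Σ i, ZMod (2 * k i + 1)) ⊕ W
    | .inl ⟨j, a⟩ => if j = i then .inl ⟨j, a⟩ else familyMatch m₀ s (.inl ⟨j, a⟩)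
    | .inr w => .inr (m₀ w)
  have hmi : ∀ a, m (.inl ⟨i, a⟩) = .inl ⟨i, a⟩ := fun a => if_pos rfl
  have hmj : ∀ j a, j ≠ i → m (.inl ⟨j, a⟩) = familyMatch m₀ s (.inl ⟨j, a⟩) :=
    fun j a h => if_neg h
  have hmr : ∀ w, m (.inr w) = .inr (m₀ w) := fun w => rfl
  clear_value m
  have hm : Function.Involutive m := by
    rintro (⟨j, a⟩ | w)
    · by_cases hj : j = i
      · subst hj
        rw [hmi, hmi]
      · rw [hmj j a hj]
        simp only [familyMatch]
        rw [hmj j _ hj]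
        simp only [familyMatch]
        rw [cycleMatch_involutive]
    · rw [hmr, hmr, hm₀]
  obtain ⟨a, ha⟩ : ∃ a : ZMod (2 * k i + 1), ∀ b, b ≠ a →
      ¬ Conn m p (.inl ⟨i, a⟩) (.inl ⟨i, b⟩) := by
    by_contra! hcon
    choose g hg hconn using hcon
    obtain ⟨a, ha⟩ := exists_fixed_of_involutive (g := g) fun a => by
      have := eq_of_uncovered hm hp (u := .inl ⟨i, g a⟩) (v := .inl ⟨i, g (g a)⟩)
        (w := .inl ⟨i, a⟩) (hmi _) (hmi _) (hmi _) (hconn (g a)) (hconn a).symm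
        (by simpa using hg (g a)) (by simpa using (hg a).symm)
      simpa using this
    exact hg a ha
  refine ⟨a, fun hA => ?_⟩
  have hconn := (hA.conn hm₀ hp).1
  simp only [near, Function.update_self, add_zero] at hconn
  refine ha (a + 1) (add_one_ne_self (hk i) a) ?_
  refine Conn.mem_of_stable (S := {x | Conn m p (.inl ⟨i, a⟩) x})
    (familyMatch_involutive hm₀ _) hp ?_ (fun x hx => conn_right_iff.2 hx) hconn (Conn.refl _)
  rintro (⟨j, b⟩ | w) hx
  · by_cases hj : j = i
    · subst hj
      obtain rfl : b = a := by_contra fun hb => ha b hb hx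
      simpa [familyMatch, cycleMatch_self] using hx
    · have : familyMatch m₀ (Function.update s i a) (.inl ⟨j, b⟩) = m (.inl ⟨j, b⟩) := by
        rw [hmj j b hj]
        simp only [familyMatch]
        rw [Function.update_of_ne hj]
      rw [this]
      exact conn_left_iff.2 hx
  · have := (conn_left_iff (m := m)).2 hx
    rwa [hmr] at this

/-- Moving the uncovered vertex of an always bad cycle by two steps keeps all components, and
changes the matching only within the component of that vertex. -/
theorem AlwaysBad.slide [Finite ι] [Finite W] (hk : ∀ i, 0 < k i)
    (hm₀ : Function.Involutive m₀) (hp : Function.Involutive p) (h : AlwaysBad m₀ p s i) :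
    (∀ x y, Conn (familyMatch m₀ s) p x y ↔
        Conn (familyMatch m₀ (Function.update s i (s i + 2))) p x y) ∧
      ∀ x, ¬ Conn (familyMatch m₀ s) p (near W s i 0) x →
        familyMatch m₀ (Function.update s i (s i + 2)) x = familyMatch m₀ s x := by
  obtain ⟨c, hc⟩ := exists_isProper (familyMatch_involutive hm₀ s) hp
  have hcb := (h c hc).1
  have hconn := (h.conn hm₀ hp).1
  have hmv : familyMatch m₀ s (near W s i 1) = near W s i 2 := by
    simp [familyMatch, near, cycleMatch_add_one (hk i)]
  have heq : ∀ x, x ≠ near W s i 0 → x ≠ near W s i 1 → x ≠ near W s i 2 →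
      familyMatch m₀ (Function.update s i (s i + 2)) x = familyMatch m₀ s x := by
    rintro (⟨j, a⟩ | w) h0 h1 h2
    · by_cases hj : j = i
      · subst hj
        simp only [near, add_zero, ne_eq, Sum.inl.injEq, Sigma.mk.injEq, heq_eq_eq, true_and]
          at h0 h1 h2
        simp only [familyMatch, Function.update_self]
        rw [cycleMatch_add_two _ h0 h1 h2]
      · simp only [familyMatch]
        rw [Function.update_of_ne hj]
    · rfl
  constructor
  · intro x y
    refine conn_slide_iff (u := near W s i 0) (v := near W s i 1) (w := near W s i 2)
      (familyMatch_involutive hm₀ s) hp (familyMatch_near_zero m₀ s i) hmv ?_ ?_ ?_ ?_ heq hc hcb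
      hconn
    · simp [familyMatch, near, cycleMatch_self]
    · simp [familyMatch, near, cycleMatch_add_two_self (hk i)]
    · simp [familyMatch, near, cycleMatch_add_two_add_one (hk i)]
    · simpa [near] using (add_one_ne_self (hk i) (s i)).symm
  · refine fun x hx => heq x ?_ ?_ ?_
    · rintro rfl
      exact hx (Conn.refl _)
    · rintro rfl
      exact hx hconn
    · rintro rfl
      rw [← hmv, conn_left_iff] at hx
      exact hx hconn

/-- Repeated sliding makes an always bad cycle not always bad. -/
theorem AlwaysBad.exists_slide [Finite ι] [Finite W] (hk : ∀ i, 0 < k i)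
    (hm₀ : Function.Involutive m₀) (hp : Function.Involutive p) (h : AlwaysBad m₀ p s i) :
    ∃ b, ¬ AlwaysBad m₀ p (Function.update s i b) i ∧
      (∀ x y, Conn (familyMatch m₀ s) p x y ↔
        Conn (familyMatch m₀ (Function.update s i b)) p x y) ∧
      ∀ x, ¬ Conn (familyMatch m₀ s) p (near W s i 0) x →
        familyMatch m₀ (Function.update s i b) x = familyMatch m₀ s x := by
  by_contra! hcon
  have key : ∀ t : ℕ, AlwaysBad m₀ p (Function.update s i (s i + 2 * (t : ZMod _))) i ∧
      (∀ x y, Conn (familyMatch m₀ s) p x y ↔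
        Conn (familyMatch m₀ (Function.update s i (s i + 2 * (t : ZMod _)))) p x y) ∧
      (∀ x, ¬ Conn (familyMatch m₀ s) p (near W s i 0) x →
        familyMatch m₀ (Function.update s i (s i + 2 * (t : ZMod _))) x = familyMatch m₀ s x) ∧
      Conn (familyMatch m₀ s) p (near W s i 0) (.inl ⟨i, s i + 2 * (t : ZMod _)⟩) := by
    intro t
    induction t with
    | zero => simpa [near] using ⟨h, Conn.refl _⟩
    | succ t ih =>
      obtain ⟨h1, h2, h3, h4⟩ := ih
      obtain ⟨h5, h6⟩ := h1.slide hk hm₀ hp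
      have hst : s i + 2 * ((t + 1 : ℕ) : ZMod (2 * k i + 1)) =
          s i + 2 * (t : ZMod _) + 2 := by
        push_cast
        ring
      rw [hst]
      simp only [Function.update_idem, Function.update_self, near, add_zero, ← h2] at h5 h6
      have h7 : ∀ x, ¬ Conn (familyMatch m₀ s) p (near W s i 0) x →
          familyMatch m₀ (Function.update s i (s i + 2 * (t : ZMod _) + 2)) x =
            familyMatch m₀ s x :=
        fun x hx => (h6 x fun hx' => hx (h4.trans hx')).trans (h3 x hx)
      refine ⟨?_, fun x y => h5 x y, h7, ?_⟩
      · by_contra hA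
        obtain ⟨x, hx, hne⟩ := hcon _ hA fun x y => h5 x y
        exact hne (h7 x hx)
      · -- the new uncovered vertex is the neighbour of a vertex of the same component
        have hc1 := (h1.conn hm₀ hp).1
        rw [← h2] at hc1
        have hc2 := h4.trans (by simpa [near] using hc1)
        refine hc2.trans ((h2 _ _).2 ?_)
        have := Conn.left (m := familyMatch m₀ (Function.update s i (s i + 2 * (t : ZMod _))))
          (p := p) (.inl ⟨i, s i + 2 * (t : ZMod _) + 1⟩)
        simpa [familyMatch, cycleMatch_add_one (hk i)] using this
  obtain ⟨a, ha⟩ := exists_not_alwaysBad hk hm₀ hp s i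
  obtain ⟨t, rfl⟩ := exists_add_two_mul (s i) a
  exact ha (key t).1

open Classical in
/-- If the uncovered vertices are chosen so as to minimise the number of always bad cycles, then
there are at least as many never bad cycles: by minimality, sliding the uncovered vertex of an
always bad cycle makes another cycle always bad, which was never bad before and whose uncovered
vertex is the other end of the same path. -/
theorem exists_card_alwaysBad_le [Fintype ι] [Finite W] (hk : ∀ i, 0 < k i)
    (hm₀ : Function.Involutive m₀) (hp : Function.Involutive p) :
    ∃ s : ∀ i, ZMod (2 * k i + 1),
      ({i | AlwaysBad m₀ p s i} : Finset ι).card ≤ ({i | NeverBad m₀ p s i} : Finset ι).card := by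
  obtain ⟨s, hs⟩ := Finite.exists_min
    fun s : ∀ i, ZMod (2 * k i + 1) => ({i | AlwaysBad m₀ p s i} : Finset ι).card
  obtain ⟨c₀, hc₀⟩ := exists_isProper (familyMatch_involutive hm₀ s) hp
  have key : ∀ i, AlwaysBad m₀ p s i → ∃ j, NeverBad m₀ p s j ∧
      Conn (familyMatch m₀ s) p (near W s i 0) (near W s j 0) := by
    intro i hi
    obtain ⟨b, hb, hconn, hoff⟩ := hi.exists_slide hk hm₀ hp
    set s' := Function.update s i b with hs'
    obtain ⟨j, hj', hj⟩ : ∃ j, AlwaysBad m₀ p s' j ∧ ¬ AlwaysBad m₀ p s j := by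
      by_contra! hcon
      refine absurd (hs s') (not_le.2 (Finset.card_lt_card ?_))
      refine ⟨Finset.monotone_filter_right _ fun j _ h => hcon j h, fun hsub => ?_⟩
      exact hb (by simpa using hsub (by simpa using hi))
    have hji : j ≠ i := by
      rintro rfl
      exact hj hi
    have hnear : ∀ d, near W s' j d = near W s j d := fun d => by
      simp only [near, hs']
      rw [Function.update_of_ne hji]
    have hbad : ∀ c : (Σ i, ZMod (2 * k i + 1)) ⊕ W → Bool, IsBad s' j c ↔ IsBad s j c :=
      fun c => by simp only [IsBad, hnear]
    have hcj := hj'.conn hm₀ hp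
    simp only [← hconn, hnear] at hcj
    unfold AlwaysBad at hj
    push Not at hj
    obtain ⟨c, hc, hcb⟩ := hj
    refine ⟨j, fun c' hc' hcb' => hcb ((hc'.isBad_iff hc hcj).1 hcb'), ?_⟩
    by_contra hQ
    obtain ⟨c', hc'⟩ := exists_isProper (familyMatch_involutive hm₀ s') hp
    -- `c'` on the component of the moved vertex, `c` elsewhere
    let d : (Σ i, ZMod (2 * k i + 1)) ⊕ W → Bool :=
      fun x => if Conn (familyMatch m₀ s) p (near W s i 0) x then c' x else c x
    have hd : ∀ x, ¬ Conn (familyMatch m₀ s) p (near W s i 0) x → d x = c x := fun x hx => if_neg hx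
    have hdP : IsProper (familyMatch m₀ s') p d := by
      constructor
      · intro x hx
        have hx' : Conn (familyMatch m₀ s) p (near W s i 0) (familyMatch m₀ s' x) ↔
            Conn (familyMatch m₀ s) p (near W s i 0) x := by
          rw [hconn, hconn, conn_left_iff]
        simp only [d, hx']
        split_ifs with h
        · exact hc'.1 x hx
        · rw [hoff x h] at hx ⊢
          exact hc.1 x hx
      · intro x hx
        simp only [d, conn_right_iff]
        split_ifs with h
        · exact hc'.2 x hx
        · exact hc.2 x hx
    refine hcb ?_
    have := (hbad d).1 (hj' d hdP)
    unfold IsBad at this ⊢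
    rwa [hd _ hQ, hd _ fun h => hQ (h.trans hcj.1.symm), hd _ fun h => hQ (h.trans hcj.2.symm)]
      at this
  choose! D hD hconnD using key
  refine ⟨s, Finset.card_le_card_of_injOn D (fun i hi => ?_) fun i hi j hj hij => ?_⟩
  · simp only [Finset.coe_filter, Finset.mem_univ, true_and, Set.mem_ofPred_eq] at hi ⊢
    exact hD i hi
  · simp only [Finset.coe_filter, Finset.mem_univ, true_and, Set.mem_ofPred_eq] at hi hj
    have hne : ∀ i, AlwaysBad m₀ p s i → near W s i 0 ≠ near W s (D i) 0 := by
      intro i hi h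
      have hDi : i = D i := by
        simp only [near, Sum.inl.injEq, Sigma.mk.injEq] at h
        exact h.1
      exact hD i hi c₀ hc₀ (hDi ▸ hi c₀ hc₀)
    have := eq_of_uncovered (familyMatch_involutive hm₀ s) hp (familyMatch_near_zero m₀ s (D i))
      (familyMatch_near_zero m₀ s i) (familyMatch_near_zero m₀ s j) (hconnD i hi).symm
      (hij ▸ (hconnD j hj).symm) (hne i hi) (hij ▸ hne j hj)
    simp only [near, Sum.inl.injEq, Sigma.mk.injEq] at this
    exact this.1

open Classical in
/-- Given disjoint odd cycles and two matchings, one of them avoiding the cycles, near-perfect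
matchings of the cycles can be added to the latter so that some proper colouring has at most half of
the cycles bad. -/
theorem exists_few_isBad [Fintype ι] [Finite W] (hk : ∀ i, 0 < k i)
    (hm₀ : Function.Involutive m₀) (hp : Function.Involutive p) :
    ∃ (s : ∀ i, ZMod (2 * k i + 1)) (c : (Σ i, ZMod (2 * k i + 1)) ⊕ W → Bool),
      IsProper (familyMatch m₀ s) p c ∧
        2 * ({i | IsBad s i c} : Finset ι).card ≤ Fintype.card ι := by
  have := Fintype.ofFinite W
  obtain ⟨s, hs⟩ := exists_card_alwaysBad_le (k := k) hk hm₀ hp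
  exact ⟨s, exists_two_mul_card_isBad_le hm₀ hp hs⟩

end Family

end TwoMatchings

/-! ### Cycles in graphs of maximum degree two -/

namespace SimpleGraph

variable {V : Type*} {H : SimpleGraph V}

section DegreeTwo

variable [Finite V] (hH : ∀ v, (H.neighborSet v).ncard ≤ 2) {u : V} {C : H.Walk u u}

include hH

theorem Walk.IsCycle.toSubgraph_adj_iff_of_degree_le_two (hC : C.IsCycle) {x y : V}
    (hx : x ∈ C.support) : C.toSubgraph.Adj x y ↔ H.Adj x y := by
  have h : C.toSubgraph.neighborSet x = H.neighborSet x :=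
    Set.eq_of_subset_of_ncard_le (C.toSubgraph.neighborSet_subset x)
      ((hH x).trans (hC.ncard_neighborSet_toSubgraph_eq_two hx).ge) (Set.toFinite _)
  exact Set.ext_iff.1 h y

/-- In a graph of maximum degree two a cycle is a whole connected component. -/
theorem Walk.IsCycle.mem_support_iff_reachable (hC : C.IsCycle) {x y : V} (hx : x ∈ C.support) :
    y ∈ C.support ↔ H.Reachable x y := by
  classical
  constructor
  · exact fun hy => ((C.takeUntil x hx).reachable.symm).trans (C.takeUntil y hy).reachable
  · rintro ⟨p⟩
    induction p with
    | nil => exact hx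
    | cons h _ ih =>
      refine ih ?_
      rw [← Walk.mem_verts_toSubgraph]
      exact C.toSubgraph.edge_vert ((hC.toSubgraph_adj_iff_of_degree_le_two hH hx).2 h).symm

theorem Walk.IsCycle.toSubgraph_eq (hC : C.IsCycle) {v : V} {D : H.Walk v v} (hD : D.IsCycle)
    {x : V} (hxC : x ∈ C.support) (hxD : x ∈ D.support) : C.toSubgraph = D.toSubgraph := by
  have h : ∀ y, y ∈ C.support ↔ y ∈ D.support := fun y => by
    rw [hC.mem_support_iff_reachable hH hxC, hD.mem_support_iff_reachable hH hxD]
  ext a b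
  · simpa using h a
  · constructor
    · intro hab
      have ha : a ∈ C.support := by simpa using C.toSubgraph.edge_vert hab
      exact (hD.toSubgraph_adj_iff_of_degree_le_two hH ((h a).1 ha)).2 hab.adj_sub
    · intro hab
      have ha : a ∈ D.support := by simpa using D.toSubgraph.edge_vert hab
      exact (hC.toSubgraph_adj_iff_of_degree_le_two hH ((h a).2 ha)).2 hab.adj_sub

omit [Finite V] hH in
theorem Walk.IsCycle.exists_getVert_eq (hC : C.IsCycle) {x : V} (hx : x ∈ C.support) :
    ∃ i < C.length, C.getVert i = x := by
  obtain ⟨i, rfl, hi⟩ := Walk.mem_support_iff_exists_getVert.1 hx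
  rcases hi.lt_or_eq with h | h
  · exact ⟨i, h, rfl⟩
  · exact ⟨0, by have := hC.three_le_length; omega, by simp [h]⟩

theorem Walk.IsCycle.adj_getVert (hC : C.IsCycle) {i : ℕ} (hi : i < C.length) {y : V}
    (h : H.Adj (C.getVert i) y) :
    ∃ j < C.length, C.getVert j = y ∧ (j = i + 1 ∨ i = j + 1 ∨ (i = 0 ∧ j + 1 = C.length) ∨
      (j = 0 ∧ i + 1 = C.length)) := by
  have h3 := hC.three_le_length
  have hy : y ∈ C.toSubgraph.neighborSet (C.getVert i) :=
    (hC.toSubgraph_adj_iff_of_degree_le_two hH (C.getVert_mem_support i)).2 h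
  rcases Nat.eq_zero_or_pos i with rfl | hi0
  · rw [Walk.getVert_zero, hC.neighborSet_toSubgraph_endpoint] at hy
    rcases hy with rfl | rfl
    · exact ⟨1, by omega, rfl, by omega⟩
    · exact ⟨C.length - 1, by omega, rfl, by omega⟩
  · rw [hC.neighborSet_toSubgraph_internal hi0.ne' hi] at hy
    rcases hy with rfl | rfl
    · exact ⟨i - 1, by omega, rfl, by omega⟩
    · by_cases hi' : i + 1 < C.length
      · exact ⟨i + 1, hi', rfl, by omega⟩
      · have : i + 1 = C.length := by omega
        exact ⟨0, by omega, by simp [this], by omega⟩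

omit [Finite V] hH in
theorem Walk.IsCycle.getVert_inj (hC : C.IsCycle) {i j : ℕ} (hi : i < C.length)
    (hj : j < C.length) (h : C.getVert i = C.getVert j) : i = j :=
  hC.getVert_injOn' (by rw [Set.mem_ofPred_eq]; omega) (by rw [Set.mem_ofPred_eq]; omega) h

/-- A cyclic enumeration of the vertices of a long odd cycle. -/
theorem exists_enum_of_mem_longOddCycles {C : H.Subgraph} (hC : C ∈ H.longOddCycles) :
    ∃ k : ℕ, 2 ≤ k ∧ ∃ w : ZMod (2 * k + 1) → V, Function.Injective w ∧ Set.range w = C.verts ∧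
      ∀ a y, H.Adj (w a) y → y = w (a + 1) ∨ y = w (a - 1) := by
  obtain ⟨v, p, hp, ⟨k, hk⟩, h3, rfl⟩ := hC
  refine ⟨k, by omega, fun a => p.getVert a.val, fun a b hab => ?_, ?_, fun a y h => ?_⟩
  · exact ZMod.val_injective _
      (hp.getVert_inj (by rw [hk]; exact ZMod.val_lt a) (by rw [hk]; exact ZMod.val_lt b) hab)
  · ext x
    rw [Walk.mem_verts_toSubgraph]
    constructor
    · rintro ⟨a, rfl⟩
      exact p.getVert_mem_support _
    · intro hx
      obtain ⟨i, hi, rfl⟩ := hp.exists_getVert_eq hx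
      exact ⟨(i : ZMod _), by simp only [ZMod.val_natCast_of_lt (hk ▸ hi)]⟩
  · obtain ⟨j, hj, rfl, hij⟩ := hp.adj_getVert hH (by rw [hk]; exact ZMod.val_lt a) h
    rw [hk] at hj hij
    have ha : ((a.val : ℕ) : ZMod (2 * k + 1)) = a := ZMod.natCast_zmod_val a
    have hjv : ∀ b : ZMod (2 * k + 1), (j : ZMod (2 * k + 1)) = b →
        p.getVert j = p.getVert b.val := by
      rintro b rfl
      rw [ZMod.val_natCast_of_lt hj]
    have hn : ((2 * k + 1 : ℕ) : ZMod (2 * k + 1)) = 0 := ZMod.natCast_self _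
    rcases hij with h | h | ⟨h, h'⟩ | ⟨h, h'⟩
    · exact Or.inl (hjv _ (by rw [h]; push_cast; rw [ha]))
    · refine Or.inr (hjv _ ?_)
      rw [← ha, h]
      push_cast
      ring
    · refine Or.inr (hjv _ ?_)
      have h2 : ((j + 1 : ℕ) : ZMod (2 * k + 1)) = 0 := (congrArg Nat.cast h').trans hn
      rw [← ha, h, eq_sub_iff_add_eq]
      push_cast at h2 ⊢
      exact h2
    · refine Or.inl (hjv _ ?_)
      have h2 : ((a.val + 1 : ℕ) : ZMod (2 * k + 1)) = 0 := (congrArg Nat.cast h').trans hn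
      push_cast at h2
      rw [ha] at h2
      rw [h, h2, Nat.cast_zero]

theorem disjoint_longOddCycles {C D : H.Subgraph} (hC : C ∈ H.longOddCycles)
    (hD : D ∈ H.longOddCycles) {x : V} (hxC : x ∈ C.verts) (hxD : x ∈ D.verts) : C = D := by
  obtain ⟨u, p, hp, -, -, rfl⟩ := hC
  obtain ⟨v, q, hq, -, -, rfl⟩ := hD
  exact hp.toSubgraph_eq hH hq (by simpa using hxC) (by simpa using hxD)

theorem mem_verts_iff_reachable {C : H.Subgraph} (hC : C ∈ H.longOddCycles) {x y : V}
    (hx : x ∈ C.verts) : y ∈ C.verts ↔ H.Reachable x y := by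
  obtain ⟨u, p, hp, -, -, rfl⟩ := hC
  rw [Walk.mem_verts_toSubgraph] at hx ⊢
  exact hp.mem_support_iff_reachable hH hx

theorem mem_iUnion_longOddCycles_iff {x y : V} (h : H.Reachable x y) :
    (x ∈ ⋃ C ∈ H.longOddCycles, C.verts) ↔ y ∈ ⋃ C ∈ H.longOddCycles, C.verts := by
  simp only [Set.mem_iUnion, exists_prop]
  exact ⟨fun ⟨C, hC, hx⟩ => ⟨C, hC, (mem_verts_iff_reachable hH hC hx).2 h⟩,
    fun ⟨C, hC, hx⟩ => ⟨C, hC, (mem_verts_iff_reachable hH hC hx).2 h.symm⟩⟩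

/-! ### Components that are not long odd cycles -/

omit [Finite V] hH in
theorem exists_adj_dist_eq {u y : V} {n : ℕ} (hy : H.Reachable u y) (hn : H.dist u y = n + 1) :
    ∃ z, H.Reachable u z ∧ H.dist u z = n ∧ H.Adj z y := by
  obtain ⟨p, hp⟩ := hy.symm.exists_walk_length_eq_dist
  rw [dist_comm, hn] at hp
  cases p with
  | nil => simp at hp
  | cons h q =>
    rename_i z
    rw [Walk.length_cons] at hp
    have h1 : H.dist z u ≤ n := (dist_le q).trans (by omega)
    have h2 := h.symm.diff_dist_adj (u := u)
    rw [dist_comm] at h1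
    exact ⟨z, q.reachable.symm, by omega, h.symm⟩

/-- In a component with a vertex of degree at most one, a path, the distance from that vertex
determines a vertex. -/
theorem eq_of_dist_eq {u : V} (hu : (H.neighborSet u).ncard ≤ 1) (n : ℕ) :
    ∀ y z, H.Reachable u y → H.Reachable u z → H.dist u y = n → H.dist u z = n → y = z := by
  induction n using Nat.strong_induction_on with
  | _ n ih =>
    intro y z hy hz hyn hzn
    rcases n with _ | _ | n
    · rw [hy.dist_eq_zero_iff] at hyn
      rw [hz.dist_eq_zero_iff] at hzn
      rw [← hyn, hzn]
    · rw [Set.ncard_le_one (Set.toFinite _)] at hu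
      exact hu y (by simpa using hyn) z (by simpa using hzn)
    · obtain ⟨y₁, hy₁, hyn₁, hyy⟩ := exists_adj_dist_eq hy hyn
      obtain ⟨z₁, hz₁, hzn₁, hzz⟩ := exists_adj_dist_eq hz hzn
      obtain rfl := ih (n + 1) (by omega) y₁ z₁ hy₁ hz₁ hyn₁ hzn₁
      obtain ⟨x, -, hxn, hx⟩ := exists_adj_dist_eq hy₁ hyn₁
      by_contra hne
      have h3 : ({x, y, z} : Set V).ncard = 3 := by
        rw [Set.ncard_eq_three]
        exact ⟨x, y, z, by rintro rfl; omega, by rintro rfl; omega, hne, rfl⟩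
      have hsub : ({x, y, z} : Set V) ⊆ H.neighborSet y₁ := by
        rintro _ (rfl | rfl | rfl)
        exacts [hx.symm, hyy, hzz]
      have := (Set.ncard_le_ncard hsub (Set.toFinite _)).trans (hH y₁)
      omega

/-- The vertices of a component that is not a long odd cycle can be numbered so that adjacent
vertices have consecutive numbers, or the first and last number of a cycle whose length `n` is even
or `3`; the value `n = 0` stands for a path. -/
theorem exists_numbering {x : V} (hx : x ∉ ⋃ C ∈ H.longOddCycles, C.verts) :
    ∃ (l : V → ℕ) (n : ℕ), (Even n ∨ n = 3) ∧ (∀ y, H.Reachable x y → n = 0 ∨ l y < n) ∧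
      (∀ y z, H.Reachable x y → H.Reachable x z → l y = l z → y = z) ∧
      ∀ y z, H.Reachable x y → H.Adj y z →
        l z = l y + 1 ∨ l y = l z + 1 ∨ (l y = 0 ∧ l z + 1 = n) ∨ (l z = 0 ∧ l y + 1 = n) := by
  by_cases h1 : ∃ u, H.Reachable x u ∧ (H.neighborSet u).ncard ≤ 1
  · obtain ⟨u, hxu, hu⟩ := h1
    refine ⟨H.dist u, 0, Or.inl (by simp), fun _ _ => Or.inl rfl, fun y z hy hz h => ?_,
      fun y z hy hyz => ?_⟩
    · exact eq_of_dist_eq hH hu _ y z (hxu.symm.trans hy) (hxu.symm.trans hz) h rfl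
    · have hne : H.dist u z ≠ H.dist u y := fun h => hyz.ne
        (eq_of_dist_eq hH hu _ y z (hxu.symm.trans hy) (hxu.symm.trans (hy.trans hyz.reachable))
          rfl h)
      have := hyz.diff_dist_adj (u := u)
      omega
  · push Not at h1
    -- the component of `x` is `2`-regular, hence a cycle
    let H' : SimpleGraph V :=
      { Adj := fun a b => H.Adj a b ∧ H.Reachable x a
        symm := ⟨fun a b h => ⟨h.1.symm, h.2.trans h.1.reachable⟩⟩
        loopless := ⟨fun a h => h.1.ne rfl⟩ }
    have hle : H' ≤ H := fun a b h => h.1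
    have hns : ∀ v, H.Reachable x v → H'.neighborSet v = H.neighborSet v := by
      intro v hv
      ext b
      exact ⟨fun h => h.1, fun h => ⟨h, hv⟩⟩
    have hcard : ∀ v, H.Reachable x v → (H'.neighborSet v).ncard = 2 := fun v hv => by
      rw [hns v hv]
      exact le_antisymm (hH v) (h1 v hv)
    have hcyc : H'.IsCycles := fun v ⟨b, hb⟩ => hcard v hb.2
    have hne : (H'.neighborSet x).Nonempty :=
      Set.nonempty_of_ncard_ne_zero (by rw [hcard x (Reachable.refl x)]; omega)
    obtain ⟨p, hp, -⟩ := hcyc.exists_cycle_toSubgraph_verts_eq_connectedComponentSupp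
      (c := H'.connectedComponentMk x) rfl hne
    obtain ⟨C, hC⟩ : ∃ C : H.Walk x x, C.IsCycle := ⟨p.mapLe hle, hp.mapLe hle⟩
    have hmem : ∀ y, H.Reachable x y → ∃ i < C.length, C.getVert i = y := fun y hy =>
      hC.exists_getVert_eq ((hC.mem_support_iff_reachable hH C.start_mem_support).2 hy)
    choose! l hl hlv using hmem
    have h3 := hC.three_le_length
    refine ⟨l, C.length, ?_, fun y hy => Or.inr (hl y hy), fun y z hy hz h => ?_,
      fun y z hy hyz => ?_⟩
    · by_contra! hcon
      refine hx (Set.mem_iUnion₂.2 ⟨C.toSubgraph, ⟨x, C, hC, ?_, by omega, rfl⟩, by simp⟩)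
      exact Nat.not_even_iff_odd.1 hcon.1
    · rw [← hlv y hy, ← hlv z hz, h]
    · have hz := hy.trans hyz.reachable
      obtain ⟨j, hj, hjz, hjl⟩ := hC.adj_getVert hH (hl y hy) (y := z) (by rwa [hlv y hy])
      obtain rfl : j = l z := hC.getVert_inj hj (hl z hz) (by rw [hjz, hlv z hz])
      omega

/-- Off the long odd cycles there is a matching of vertices such that a colouring that is proper on
it has monochromatic degree at most one in `H`: in each component, match the vertices with
numbers `2 * j` and `2 * j + 1`. -/
theorem exists_matching_off_longOddCycles :
    ∃ R : V → V → Prop, (∀ x y, R x y → R y x) ∧ (∀ x y z, R x y → R x z → y = z) ∧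
      (∀ x, ¬ R x x) ∧
      ∀ c : V → Bool,
        (∀ x y, x ∉ ⋃ C ∈ H.longOddCycles, C.verts → y ∉ ⋃ C ∈ H.longOddCycles, C.verts →
          R x y → c x ≠ c y) →
        ∀ x y z, x ∉ ⋃ C ∈ H.longOddCycles, C.verts → H.Adj x y → H.Adj x z →
          c x = c y → c x = c z → y = z := by
  set U := ⋃ C ∈ H.longOddCycles, C.verts with hU
  have hnum := fun x (hx : x ∉ U) => exists_numbering hH hx
  choose! l n hn hbd hinj hadj using hnum
  let r : V → V := fun x => (H.connectedComponentMk x).out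
  have hr : ∀ x, H.Reachable (r x) x := fun x =>
    ConnectedComponent.exact (Quot.out_eq (H.connectedComponentMk x))
  have hrr : ∀ x y, H.Reachable x y → r x = r y := fun x y h => by
    simp only [r, ConnectedComponent.sound h]
  refine ⟨fun x y => x ∉ U ∧ H.Reachable x y ∧ l (r x) x ≠ l (r x) y ∧
    l (r x) x / 2 = l (r x) y / 2, ?_, ?_, ?_, ?_⟩
  · rintro x y ⟨hx, h1, h2, h3⟩
    refine ⟨fun h => hx ((mem_iUnion_longOddCycles_iff hH h1).2 h), h1.symm, ?_⟩
    rw [← hrr x y h1]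
    exact ⟨h2.symm, h3.symm⟩
  · rintro x y z ⟨hx, h1, h2, h3⟩ ⟨-, h4, h5, h6⟩
    refine hinj (r x) (fun h => hx ((mem_iUnion_longOddCycles_iff hH (hr x)).1 h)) y z
      ((hr x).trans h1) ((hr x).trans h4) ?_
    omega
  · rintro x ⟨-, -, h, -⟩
    exact h rfl
  · intro c hc x y z hx hxy hxz hcy hcz
    have hrx : r x ∉ U := fun h => hx ((mem_iUnion_longOddCycles_iff hH (hr x)).1 h)
    have hyU : y ∉ U := fun h => hx ((mem_iUnion_longOddCycles_iff hH hxy.reachable).2 h)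
    have hzU : z ∉ U := fun h => hx ((mem_iUnion_longOddCycles_iff hH hxz.reachable).2 h)
    have hxy' := hadj (r x) hrx x y (hr x) hxy
    have hxz' := hadj (r x) hrx x z (hr x) hxz
    have hnr := hn (r x) hrx
    by_contra hne
    have hlne : l (r x) y ≠ l (r x) z := fun h => hne (hinj (r x) hrx y z
      ((hr x).trans hxy.reachable) ((hr x).trans hxz.reachable) h)
    have key : ∀ a b, a ∉ U → b ∉ U → H.Reachable x a → H.Reachable x b → c a = c b →
        l (r x) a ≠ l (r x) b → l (r x) a / 2 ≠ l (r x) b / 2 := by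
      intro a b ha hb hxa hxb hcab h1 h2
      refine hc a b ha hb ⟨ha, hxa.symm.trans hxb, ?_⟩ hcab
      rw [← hrr x a hxa]
      exact ⟨h1, h2⟩
    have k1 := key x y hx hyU (Reachable.refl x) hxy.reachable hcy
    have k2 := key x z hx hzU (Reachable.refl x) hxz.reachable hcz
    have k3 := key y z hyU hzU hxy.reachable hxz.reachable (hcy.symm.trans hcz)
    have b1 := hbd (r x) hrx x (hr x)
    have b2 := hbd (r x) hrx y ((hr x).trans hxy.reachable)
    have b3 := hbd (r x) hrx z ((hr x).trans hxz.reachable)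
    rcases hnr with ⟨m, hm⟩ | hm <;> omega

end DegreeTwo

/-! ### Colouring the glued graph -/

open TwoMatchings

variable {V : Type*} {H : SimpleGraph V}

/-- The vertex set is the disjoint union of the long odd cycles, enumerated cyclically, and of the
remaining vertices. -/
theorem exists_equiv_longOddCycles [Finite V] (hH : ∀ v, (H.neighborSet v).ncard ≤ 2) :
    ∃ (k : H.longOddCycles → ℕ)
      (e : (Σ C, ZMod (2 * k C + 1)) ⊕ {x // x ∉ ⋃ C ∈ H.longOddCycles, C.verts} ≃ V),
      (∀ C, 2 ≤ k C) ∧ (∀ C, Set.range (fun a => e (.inl ⟨C, a⟩)) = C.1.verts) ∧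
      (∀ w, e (.inr w) = w.1) ∧
      ∀ C a y, H.Adj (e (.inl ⟨C, a⟩)) y →
        y = e (.inl ⟨C, a + 1⟩) ∨ y = e (.inl ⟨C, a - 1⟩) := by
  have h := fun C : H.longOddCycles => exists_enum_of_mem_longOddCycles hH C.2
  choose k hk w hinj hrange hadj using h
  have hw : ∀ C a, w C a ∈ C.1.verts := fun C a => hrange C ▸ Set.mem_range_self a
  let e : (Σ C, ZMod (2 * k C + 1)) ⊕ {x // x ∉ ⋃ C ∈ H.longOddCycles, C.verts} → V :=
    Sum.elim (fun x => w x.1 x.2) Subtype.val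
  have he : Function.Bijective e := by
    constructor
    · rintro (⟨C, a⟩ | x) (⟨D, b⟩ | y) hxy
      · have hxy : w C a = w D b := hxy
        obtain rfl : C = D := Subtype.ext
          (disjoint_longOddCycles hH C.2 D.2 (hw C a) (hxy ▸ hw D b))
        rw [hinj C hxy]
      · exact absurd (Set.mem_iUnion₂.2 ⟨C.1, C.2, (show w C a = y.1 from hxy) ▸ hw C a⟩) y.2
      · exact absurd (Set.mem_iUnion₂.2 ⟨D.1, D.2, (show x.1 = w D b from hxy) ▸ hw D b⟩) x.2
      · exact congrArg Sum.inr (Subtype.ext hxy)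
    · intro x
      by_cases hx : x ∈ ⋃ C ∈ H.longOddCycles, C.verts
      · obtain ⟨C, hC, hxC⟩ := Set.mem_iUnion₂.1 hx
        obtain ⟨a, rfl⟩ := (hrange ⟨C, hC⟩).symm ▸ hxC
        exact ⟨.inl ⟨⟨C, hC⟩, a⟩, rfl⟩
      · exact ⟨.inr ⟨x, hx⟩, rfl⟩
  exact ⟨k, Equiv.ofBijective e he, hk, hrange, fun w => rfl, hadj⟩

/-- Some colouring splits the pairs of the matching `P` and, once one vertex is removed from each of
at most half of the long odd cycles, has monochromatic degrees at most one in `H`. -/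
theorem exists_coloring_removing_few [Finite V] (hH : ∀ v, (H.neighborSet v).ncard ≤ 2)
    {P : V → V → Prop} (hPs : ∀ x y, P x y → P y x) (hPu : ∀ x y z, P x y → P x z → y = z)
    (hPi : ∀ x, ¬ P x x) :
    ∃ (c : V → Bool) (Z : Set V), Z ⊆ (⋃ C ∈ H.longOddCycles, C.verts) ∧
      2 * Z.ncard ≤ H.longOddCycles.ncard ∧
      (∀ C ∈ H.longOddCycles, (Z ∩ C.verts).ncard ≤ 1) ∧
      (∀ x y, P x y → c x ≠ c y) ∧
      ∀ x y z, x ∉ Z → H.Adj x y → H.Adj x z → c x = c y → c x = c z → y = z := by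
  classical
  obtain ⟨R, hRs, hRu, hRi, hRc⟩ := exists_matching_off_longOddCycles hH
  obtain ⟨k, e, hk, hrange, hinr, hadj⟩ := exists_equiv_longOddCycles hH
  have : Fintype H.longOddCycles := Fintype.ofFinite _
  obtain ⟨m₀, hm₀, hm₀R, -⟩ := exists_involutive_of_matching
    (R := fun x y : {x // x ∉ ⋃ C ∈ H.longOddCycles, C.verts} => R x.1 y.1)
    (fun x y h => hRs _ _ h) fun x y z h h' => Subtype.ext (hRu _ _ _ h h')
  obtain ⟨p, hp, hpP, -⟩ := exists_involutive_of_matching (R := fun x y => P (e x) (e y))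
    (fun x y h => hPs _ _ h) fun x y z h h' => e.injective (hPu _ _ _ h h')
  obtain ⟨s, c, hc, hcard⟩ := exists_few_isBad (k := k) (fun C => by have := hk C; omega) hm₀ hp
  have hcC : ∀ (C : H.longOddCycles) (a : ZMod (2 * k C + 1)), cycleMatch (s C) a ≠ a →
      c (.inl ⟨C, cycleMatch (s C) a⟩) ≠ c (.inl ⟨C, a⟩) := by
    intro C a ha
    refine hc.1 (.inl ⟨C, a⟩) ?_
    simpa [familyMatch] using ha
  have hmem : ∀ C a, e (.inl ⟨C, a⟩) ∈ C.1.verts := fun C a => hrange C ▸ Set.mem_range_self a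
  let Z : Set V := (fun C => e (.inl ⟨C, s C⟩)) '' {C | IsBad s C c}
  refine ⟨c ∘ e.symm, Z, ?_, ?_, ?_, ?_, ?_⟩
  · rintro _ ⟨C, -, rfl⟩
    exact Set.mem_iUnion₂.2 ⟨C.1, C.2, hmem C _⟩
  · have h1 : Z.ncard ≤ {C | IsBad s C c}.ncard := Set.ncard_image_le (Set.toFinite _)
    have h2 : {C | IsBad s C c}.ncard = ({C | IsBad s C c} : Finset H.longOddCycles).card := by
      rw [← Set.ncard_coe_finset]
      congr 1
      ext C
      simp
    have h3 : H.longOddCycles.ncard = Fintype.card H.longOddCycles := by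
      rw [← Nat.card_coe_set_eq, Nat.card_eq_fintype_card]
    omega
  · intro D hD
    rw [Set.ncard_le_one (Set.toFinite _)]
    have key : ∀ x ∈ Z ∩ D.verts, x = e (.inl ⟨⟨D, hD⟩, s ⟨D, hD⟩⟩) := by
      rintro _ ⟨⟨C, -, rfl⟩, hx⟩
      obtain rfl : C = ⟨D, hD⟩ := Subtype.ext (disjoint_longOddCycles hH C.2 hD (hmem C _) hx)
      rfl
    intro x hx y hy
    rw [key x hx, key y hy]
  · intro x y hxy
    have h1 : p (e.symm x) = e.symm y := hpP _ _ (by simpa using hxy)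
    have h2 := hc.2 (e.symm x) (by
      rw [h1]
      intro h
      rw [e.symm.injective h] at hxy
      exact hPi _ hxy)
    rw [h1] at h2
    exact h2.symm
  · intro x y z hxZ hxy hxz hcy hcz
    obtain ⟨x, rfl⟩ := e.surjective x
    simp only [Function.comp_apply, Equiv.symm_apply_apply] at hcy hcz
    rcases x with ⟨C, a⟩ | w
    · have hk' : 0 < k C := by have := hk C; omega
      -- only one of the two neighbours is matched to `x`, or `x` is the uncovered vertex
      have hy := hadj C a y hxy
      have hz := hadj C a z hxz
      by_contra hne
      have hboth : c (.inl ⟨C, a⟩) = c (.inl ⟨C, a + 1⟩) ∧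
          c (.inl ⟨C, a⟩) = c (.inl ⟨C, a - 1⟩) := by
        rcases hy with rfl | rfl <;> rcases hz with rfl | rfl
        · exact absurd rfl hne
        · simpa using And.intro hcy hcz
        · simpa using And.intro hcz hcy
        · exact absurd rfl hne
      by_cases has : a = s C
      · subst has
        refine hxZ ⟨C, ?_, rfl⟩
        simpa [IsBad, near, sub_eq_add_neg] using hboth
      · rcases cycleMatch_eq_or has with h | h
        · exact hcC C a (by rw [h]; exact add_one_ne_self hk' a) (by rw [h]; exact hboth.1.symm)
        · refine hcC C a ?_ (by rw [h]; exact hboth.2.symm)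
          rw [h]
          intro h'
          exact add_one_ne_self hk' (a - 1) (by rw [sub_add_cancel, h'])
    · rw [hinr] at hxy hxz
      refine hRc (c ∘ e.symm) (fun u v hu hv huv => ?_) w.1 y z w.2 hxy hxz ?_ ?_
      · have h1 : m₀ ⟨u, hu⟩ = ⟨v, hv⟩ := hm₀R ⟨u, hu⟩ ⟨v, hv⟩ huv
        have h2 := hc.1 (.inr ⟨u, hu⟩) (by
          simp only [familyMatch, h1, ne_eq, Sum.inr.injEq, Subtype.mk.injEq]
          rintro rfl
          exact hRi _ huv)
        simp only [familyMatch, h1] at h2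
        have hu' : e.symm u = .inr ⟨u, hu⟩ := by rw [Equiv.symm_apply_eq, hinr]
        have hv' : e.symm v = .inr ⟨v, hv⟩ := by rw [Equiv.symm_apply_eq, hinr]
        simp only [Function.comp_apply, hu', hv']
        exact h2.symm
      · simpa [← hinr] using hcy
      · simpa [← hinr] using hcz

/-- Long odd cycles are disjoint and have at least five vertices each. -/
theorem five_mul_ncard_longOddCycles_le [Finite V] (hH : ∀ v, (H.neighborSet v).ncard ≤ 2) :
    5 * H.longOddCycles.ncard ≤ Nat.card V := by
  obtain ⟨k, e, hk, -⟩ := exists_equiv_longOddCycles hH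
  have : Fintype H.longOddCycles := Fintype.ofFinite _
  have h1 : Nat.card (Σ C, ZMod (2 * k C + 1)) ≤ Nat.card V :=
    Nat.card_le_card_of_injective _ (e.injective.comp Sum.inl_injective)
  have h2 : ∑ _C : H.longOddCycles, 5 ≤ ∑ C, (2 * k C + 1) :=
    Finset.sum_le_sum fun C _ => by have := hk C; omega
  rw [Nat.card_sigma] at h1
  simp only [Nat.card_zmod] at h1
  rw [Finset.sum_const, Finset.card_univ, smul_eq_mul, ← Nat.card_eq_fintype_card,
    Nat.card_coe_set_eq] at h2
  omega

end SimpleGraph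

theorem theorem2p1 {V : Type*} [Fintype V] (H : SimpleGraph V) [DecidableRel H.Adj]
    (hH : H.maxDegree ≤ 2) (q : ℕ) (f : (Σ _ : Fin q, Fin 4) ↪ V) (G : SimpleGraph V)
    (hG : G = H.glue (fun _ : Fin q => (SimpleGraph.completeGraph (Fin 4))) f) :
    ∃ Z : Set V,
      Z ⊆ (⋃ C ∈ H.longOddCycles, C.verts) ∧
      (Z.ncard : ℝ) ≤ (H.longOddCycles.ncard : ℝ) / 2 ∧
      (G.induce Zᶜ).Colorable 4 ∧
      (∀ C ∈ H.longOddCycles, (Z ∩ C.verts).ncard ≤ 1) ∧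
      (Zᶜ.ncard : ℝ) ≥ 9 / 10 * (Fintype.card V : ℝ) := by
  have hdeg : ∀ v, (H.neighborSet v).ncard ≤ 2 := fun v => by
    rw [← Nat.card_coe_set_eq, Nat.card_eq_fintype_card, SimpleGraph.card_neighborSet_eq_degree]
    exact (H.degree_le_maxDegree v).trans hH
  have hf : ∀ {i j a b}, f ⟨i, a⟩ = f ⟨j, b⟩ → i = j ∧ a = b := fun h => by
    simpa using f.injective h
  -- split each glued `K₄` into the pairs `{0, 1}` and `{2, 3}`
  obtain ⟨c, Z, hZ, hcard, hone, hcP, hcH⟩ := SimpleGraph.exists_coloring_removing_few hdeg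
    (P := fun x y => ∃ i a b, f ⟨i, a⟩ = x ∧ f ⟨i, b⟩ = y ∧ a ≠ b ∧ a.val / 2 = b.val / 2)
    (by
      rintro x y ⟨i, a, b, ha, hb, h, h'⟩
      exact ⟨i, b, a, hb, ha, h.symm, h'.symm⟩)
    (by
      rintro x y z ⟨i, a, b, rfl, rfl, h1, h2⟩ ⟨j, a', b', ha, rfl, h3, h4⟩
      obtain ⟨rfl, rfl⟩ := hf ha
      congr 2
      omega)
    (by
      rintro x ⟨i, a, b, rfl, hb, h, -⟩
      exact h (hf hb).2.symm)
  -- so each colour class contains at most two vertices of each glued `K₄`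
  have hfour : ∀ g : Fin 4 → Bool, g 0 ≠ g 1 → g 2 ≠ g 3 → ∀ a b b' : Fin 4, a ≠ b → a ≠ b' →
      g a = g b → g a = g b' → b = b' := by decide
  obtain ⟨d, hdH, hdK⟩ := TwoMatchings.exists_coloring_of_matchings
    (R := fun x y => x ∉ Z ∧ y ∉ Z ∧ H.Adj x y ∧ c x = c y)
    (S := fun x y => c x = c y ∧ ∃ i a b, a ≠ b ∧ f ⟨i, a⟩ = x ∧ f ⟨i, b⟩ = y)
    (fun x y h => ⟨h.2.1, h.1, h.2.2.1.symm, h.2.2.2.symm⟩)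
    (fun x y z h h' => hcH x y z h.1 h.2.2.1 h'.2.2.1 h.2.2.2 h'.2.2.2)
    (fun x h => h.2.2.1.ne rfl)
    (by
      rintro x y ⟨h, i, a, b, hab, ha, hb⟩
      exact ⟨h.symm, i, b, a, hab.symm, hb, ha⟩)
    (by
      rintro x y z ⟨h, i, a, b, hab, rfl, rfl⟩ ⟨h', j, a', b', hab', ha, rfl⟩
      obtain ⟨rfl, rfl⟩ := hf ha
      rw [hfour (fun a => c (f ⟨j, a⟩)) (hcP _ _ ⟨j, 0, 1, rfl, rfl, by decide, by decide⟩)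
        (hcP _ _ ⟨j, 2, 3, rfl, rfl, by decide, by decide⟩) a' b b' hab hab' h h'])
    (by
      rintro x ⟨-, i, a, b, hab, rfl, hb⟩
      exact hab (hf hb).2.symm)
  refine ⟨Z, hZ, ?_, ?_, hone, ?_⟩
  · rw [le_div_iff₀ two_pos]
    exact_mod_cast (mul_comm _ _).trans_le hcard
  · subst hG
    have col : ((H.glue (fun _ : Fin q => SimpleGraph.completeGraph (Fin 4)) f).induce
        Zᶜ).Coloring (Bool × Bool) := SimpleGraph.Coloring.mk (fun x => (c x, d x)) (by
      rintro ⟨x, hx⟩ ⟨y, hy⟩ h heq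
      obtain ⟨hc, hd⟩ := Prod.mk.inj heq
      rcases h with h | ⟨i, a, b, hab, ha, hb⟩
      · exact hdH x y ⟨hx, hy, h, hc⟩ hd
      · exact hdK x y ⟨hc, i, a, b, hab, ha, hb⟩ hd)
    simpa using col.colorable
  · have h5 := SimpleGraph.five_mul_ncard_longOddCycles_le hdeg
    have hc := Set.ncard_add_ncard_compl Z
    rw [Nat.card_eq_fintype_card] at h5 hc
    have h : 9 * Fintype.card V ≤ 10 * Zᶜ.ncard := by omega
    have h' : (9 * Fintype.card V : ℝ) ≤ 10 * Zᶜ.ncard := by exact_mod_cast h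
    linarith
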